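/- Let $f(x,y)$ be a meromorphic function on a neighbourhood $U$ of $(0,0)$ in $\mathbb{C}^2$ (that is, near every point of $U$ it is a quotient $g/h$ of holomorphic functions with $h\not\equiv 0$). By an irreducible polar divisor of $f$ at $(0,0)$ we mean the germ $\{p=0\}$ of an irreducible element $p$ of the ring of germs at $(0,0)$ of holomorphic functions such that $p$ divides $h$ for every representation $f=g/h$ by such germs (equivalently, $p$ divides the denominator of $f$ in lowest terms). Such a divisor is said to have a branching point at $(0,0)$ if, for the projection $(x,y)\mapsto x$ restricted to $\{p=0\}$, the point $(0,0)$ is isolated in its fibre, but the projection is not injective on any neighbourhood of $(0,0)$ in $\{p=0\}$. Assume the following: (i) $\{y=0\}$ is not a polar divisor of $f$ at $(0,0)$. (ii) No irreducible polar divisor of $f$ has a branching point at $(0,0)$. (iii) For every integer $n\ge 0$, the function $x\mapsto \partial_y^n\big|_{y=0} f(x,y)$, which is defined for those $x$ for which $f$ is holomorphic at $(x,0)$, admits a holomorphic continuation to a neighbourhood (possibly depending on $n$) of $x=0$. Then $f$ is holomorphic at $(0,0)$; that is, some function holomorphic in a neighbourhood of $(0,0)$ is equal to $f$ there as a meromorphic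 function. -/

import Mathlib

open Filter Topology Set

/-- `h` is holomorphic at `z` and its germ at `z` is not zero. -/
def IsNonzeroHolomorphicGerm (h : ℂ × ℂ → ℂ) (z : ℂ × ℂ) : Prop :=
  AnalyticAt ℂ h z ∧ ∃ᶠ w in 𝓝 z, h w ≠ 0

/-- Near `z`, the function `f` is the quotient `g / h` of holomorphic functions, with `h` not the
zero germ. The values of `f` on the thin set `h = 0` are irrelevant, as for any meromorphic
function. -/
def IsLocalQuotient (f g h : ℂ × ℂ → ℂ) (z : ℂ × ℂ) : Prop :=
  AnalyticAt ℂ g z ∧ IsNonzeroHolomorphicGerm h z ∧ ∀ᶠ w in 𝓝 z, h w ≠ 0 → f w = g w / h w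

/-- `f` is a meromorphic function of two variables on `U`. -/
def IsMeromorphicOnTwo (f : ℂ × ℂ → ℂ) (U : Set (ℂ × ℂ)) : Prop :=
  ∀ z ∈ U, ∃ g h : ℂ × ℂ → ℂ, IsLocalQuotient f g h z

/-- `F` is holomorphic at `z` and, near `z`, it is equal to `f` as a meromorphic function, i.e.
off the zero set of some nonzero holomorphic germ. -/
def IsHolomorphicExtensionAt (F f : ℂ × ℂ → ℂ) (z : ℂ × ℂ) : Prop :=
  AnalyticAt ℂ F z ∧
    ∃ d : ℂ × ℂ → ℂ, IsNonzeroHolomorphicGerm d z ∧ ∀ᶠ w in 𝓝 z, d w ≠ 0 → f w = F w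

/-- The meromorphic function `f` is holomorphic at `z`. -/
def MeromorphicIsHolomorphicAt (f : ℂ × ℂ → ℂ) (z : ℂ × ℂ) : Prop :=
  ∃ F : ℂ × ℂ → ℂ, IsHolomorphicExtensionAt F f z

/-- Divisibility `p ∣ h` in the local ring of holomorphic germs at `z`. -/
def HolomorphicGermDvd (p h : ℂ × ℂ → ℂ) (z : ℂ × ℂ) : Prop :=
  ∃ q : ℂ × ℂ → ℂ, AnalyticAt ℂ q z ∧ h =ᶠ[𝓝 z] fun w => p w * q w

/-- `p` is an irreducible element of the local ring of holomorphic germs at `z`; the units of this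
ring are the germs that do not vanish at `z`. -/
def IsIrreducibleHolomorphicGerm (p : ℂ × ℂ → ℂ) (z : ℂ × ℂ) : Prop :=
  AnalyticAt ℂ p z ∧ p z = 0 ∧
    ∀ a b : ℂ × ℂ → ℂ, AnalyticAt ℂ a z → AnalyticAt ℂ b z →
      (p =ᶠ[𝓝 z] fun w => a w * b w) → a z ≠ 0 ∨ b z ≠ 0

/-- The irreducible divisor germ `p = 0` at `z` is a polar divisor of `f`: the germ `p` is
irreducible, and it cannot be removed from the denominator of `f`, i.e. `f` does not belong to the
localization at the prime `(p)` of the ring of holomorphic germs at `z`. -/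
def IsPolarDivisorGerm (f p : ℂ × ℂ → ℂ) (z : ℂ × ℂ) : Prop :=
  IsIrreducibleHolomorphicGerm p z ∧
    ∀ g h : ℂ × ℂ → ℂ, IsLocalQuotient f g h z → HolomorphicGermDvd p h z

/-- The divisor `p = 0` has a branching point at `z`, with respect to the projection
`(x, y) ↦ x`: the point `z` is isolated in its fibre, but the projection of the divisor
is not injective on any neighbourhood of `z`. -/
def HasBranchingPointAt (p : ℂ × ℂ → ℂ) (z : ℂ × ℂ) : Prop :=
  (∀ᶠ y in 𝓝[≠] z.2, p (z.1, y) ≠ 0) ∧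
    ∀ V ∈ 𝓝 z, ¬ InjOn (Prod.fst : ℂ × ℂ → ℂ) {w | w ∈ V ∧ p w = 0}

/-- `a` is holomorphic at `x = 0` and continues the function `x ↦ ∂_y ^ n f (x, y)` at `y = 0`,
whose domain consists of those `x` for which the meromorphic function `f` is holomorphic at
`(x, 0)`. -/
def IsContinuationOfYDeriv (f : ℂ × ℂ → ℂ) (n : ℕ) (a : ℂ → ℂ) : Prop :=
  AnalyticAt ℂ a 0 ∧
    ∀ᶠ x in 𝓝 (0 : ℂ), ∀ F : ℂ × ℂ → ℂ, IsHolomorphicExtensionAt F f (x, 0) →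
      iteratedDeriv n (fun y : ℂ => F (x, y)) 0 = a x

/-! Since `y` is not a polar divisor, `f = g / h` near the origin with `h` not divisible by `y`, so
`h (x, 0)` has at most an isolated zero at `x = 0`, and `G = g / h` is holomorphic at `(x, 0)` for
`0 < |x| < R`. The Cauchy integral of `G` in `x` over `|ζ| = R / 2` defines `F`, holomorphic along
the whole disc `|x| < R / 2`, including the origin (`analyticAt_cauchyIntegral_fst`). Its
`y`-derivatives on the axis are the Cauchy integrals of those of `G`. The latter have removable
singularities at `x = 0` by (iii), so both families agree for `x ≠ 0`. Hence `F = G` near each such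
`(x, 0)`, and the identity theorem on vertical discs yields `h * F = g` near the origin. -/

/-! ### Cauchy integrals depending on a parameter -/

open Metric in
/-- Integration over a circle is continuous in the uniform norm. -/
theorem exists_circleIntegral_clm {r : ℝ} (hr : 0 ≤ r) :
    ∃ L : C(sphere (0 : ℂ) r, ℂ) →L[ℂ] ℂ, ∀ (φ : C(sphere (0 : ℂ) r, ℂ)) (G : ℂ → ℂ),
      (∀ ζ : sphere (0 : ℂ) r, φ ζ = G ζ) → L φ = ∮ ζ in C(0, r), G ζ := by
  let c : ℝ → sphere (0 : ℂ) r := fun θ => ⟨circleMap 0 r θ, circleMap_mem_sphere 0 hr θ⟩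
  have hc : Continuous c := (continuous_circleMap 0 r).subtype_mk _
  have hd : Continuous (deriv (circleMap 0 r)) := by
    simp only [funext (deriv_circleMap 0 r)]
    exact (continuous_circleMap 0 r).mul continuous_const
  have hi : ∀ φ : C(sphere (0 : ℂ) r, ℂ), IntervalIntegrable
      (fun θ => deriv (circleMap 0 r) θ • φ (c θ)) MeasureTheory.volume 0 (2 * Real.pi) :=
    fun φ => (hd.smul (φ.continuous.comp hc)).intervalIntegrable _ _
  let L₀ : C(sphere (0 : ℂ) r, ℂ) →ₗ[ℂ] ℂ :=
    { toFun := fun φ => ∫ θ in (0 : ℝ)..2 * Real.pi, deriv (circleMap 0 r) θ • φ (c θ)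
      map_add' := fun φ ψ => by
        rw [← intervalIntegral.integral_add (hi φ) (hi ψ)]
        simp [mul_add]
      map_smul' := fun a φ => by
        rw [RingHom.id_apply, ← intervalIntegral.integral_smul]
        simp [mul_left_comm] }
  refine ⟨L₀.mkContinuous (r * |2 * Real.pi - 0|) fun φ => ?_, fun φ G h => ?_⟩
  · have := intervalIntegral.norm_integral_le_of_norm_le_const
      (a := 0) (b := 2 * Real.pi) (C := r * ‖φ‖)
      (f := fun θ => deriv (circleMap 0 r) θ • φ (c θ)) fun θ _ => by
        rw [norm_smul, deriv_circleMap]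
        have h1 : ‖circleMap 0 r θ * Complex.I‖ = r := by simp [abs_of_nonneg hr]
        rw [h1]
        exact mul_le_mul_of_nonneg_left (φ.norm_coe_le_norm _) hr
    refine this.trans (le_of_eq ?_)
    ring
  · change ∫ θ in (0 : ℝ)..2 * Real.pi, deriv (circleMap 0 r) θ • φ (c θ) = _
    rw [circleIntegral]
    exact intervalIntegral.integral_congr fun θ _ => by simp only [h (c θ), c]

open Metric in
/-- A function of two variables that is analytic near a circle times a point is analytic in the
second variable as a map into the continuous functions on the circle. -/
theorem exists_analyticAt_continuousMap {G : ℂ × ℂ → ℂ} {r : ℝ}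
    (hG : ∀ ζ ∈ sphere (0 : ℂ) r, AnalyticAt ℂ G (ζ, 0)) :
    ∃ Γ : ℂ → C(sphere (0 : ℂ) r, ℂ), AnalyticAt ℂ Γ 0 ∧
      ∀ᶠ y in 𝓝 (0 : ℂ), ∀ ζ : sphere (0 : ℂ) r, Γ y ζ = G (ζ, y) := by
  obtain ⟨u, v, -, hv, hu, hv0, huv⟩ := generalized_tube_lemma (isCompact_sphere (0 : ℂ) r)
    (isCompact_singleton (x := (0 : ℂ))) (isOpen_analyticAt ℂ G)
    (by rintro ⟨ζ, y⟩ ⟨h1, h2⟩; obtain rfl : y = 0 := h2; exact hG ζ h1)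
  obtain ⟨δ, hδ, hδv⟩ := nhds_basis_closedBall.mem_iff.1 (hv.mem_nhds (hv0 rfl))
  have hA : ∀ ζ ∈ sphere (0 : ℂ) r, ∀ y ∈ closedBall (0 : ℂ) δ, AnalyticAt ℂ G (ζ, y) :=
    fun ζ hζ y hy => huv ⟨hu hζ, hδv hy⟩
  have hcont : Continuous fun p : closedBall (0 : ℂ) δ × sphere (0 : ℂ) r =>
      G ((p.2 : ℂ), (p.1 : ℂ)) := by
    rw [continuous_iff_continuousAt]
    intro p
    exact (hA p.2 p.2.2 p.1 p.1.2).continuousAt.comp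
      (f := fun p : closedBall (0 : ℂ) δ × sphere (0 : ℂ) r => ((p.2 : ℂ), (p.1 : ℂ)))
      (by fun_prop)
  -- Joint continuity becomes continuity in the uniform norm. The Cauchy integral of this
  -- Banach-valued map over `|η| = δ` is then analytic, and evaluation at each `ζ` identifies it
  -- with `G`.
  let K : C(closedBall (0 : ℂ) δ, C(sphere (0 : ℂ) r, ℂ)) := ContinuousMap.curry ⟨_, hcont⟩
  let Γ : ℂ → C(sphere (0 : ℂ) r, ℂ) := fun η =>
    ContinuousMap.mkD (fun ζ : sphere (0 : ℂ) r => G (ζ, η)) 0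
  have hΓK : ∀ η (h : η ∈ closedBall (0 : ℂ) δ), Γ η = K ⟨η, h⟩ := fun η h =>
    ContinuousMap.mkD_of_continuous (K ⟨η, h⟩).continuous
  have hΓ : ∀ η ∈ closedBall (0 : ℂ) δ, ∀ ζ, Γ η ζ = G (ζ, η) := fun η h ζ => by
    rw [hΓK η h]; rfl
  have hΓc : ContinuousOn Γ (closedBall 0 δ) := by
    rw [continuousOn_iff_continuous_domRestrict]
    convert K.continuous using 1
    ext1 η
    exact hΓK η η.2
  lift δ to NNReal using hδ.le
  have hint : CircleIntegrable Γ 0 δ :=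
    (hΓc.mono sphere_subset_closedBall).circleIntegrable δ.coe_nonneg
  have han := (hasFPowerSeriesOn_cauchy_integral hint (by exact_mod_cast hδ)).analyticAt
  refine ⟨_, han, ?_⟩
  filter_upwards [ball_mem_nhds (0 : ℂ) hδ] with y hy ζ
  have hsub : ∀ η ∈ sphere (0 : ℂ) δ, η - y ≠ 0 := fun η hη h0 => by
    rw [sub_eq_zero.1 h0, mem_sphere] at hη
    exact (mem_ball.1 hy).ne hη
  have hint' : CircleIntegrable (fun η => (η - y)⁻¹ • Γ η) 0 δ :=
    (((continuousOn_id.sub continuousOn_const).inv₀ hsub).smul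
      (hΓc.mono sphere_subset_closedBall)).circleIntegrable δ.coe_nonneg
  have hcomm : (∮ η in C(0, δ), (η - y)⁻¹ • Γ η) ζ = ∮ η in C(0, δ), (η - y)⁻¹ • G (ζ, η) := by
    have := (ContinuousMap.evalCLM ℂ ζ).intervalIntegral_comp_comm hint'.out
    rw [circleIntegral, ← ContinuousMap.evalCLM_apply (R := ℂ), ← this, circleIntegral]
    refine intervalIntegral.integral_congr fun θ _ => ?_
    change deriv (circleMap 0 δ) θ • (circleMap 0 δ θ - y)⁻¹ • Γ (circleMap 0 δ θ) ζ = _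
    rw [hΓ _ (sphere_subset_closedBall (circleMap_mem_sphere 0 δ.coe_nonneg θ))]
  have hdiff : DifferentiableOn ℂ (fun η => G (ζ, η)) (closedBall 0 δ) := fun η hη =>
    ((hA ζ ζ.2 η hη).differentiableAt.comp η (f := fun η : ℂ => ((ζ : ℂ), η))
      (by fun_prop)).differentiableWithinAt
  rw [ContinuousMap.smul_apply, hcomm, hdiff.circleIntegral_sub_inv_smul hy, smul_smul,
    inv_mul_cancel₀ Complex.two_pi_I_ne_zero, one_smul]

theorem ContinuousLinearMap.iteratedDeriv_comp_left {E F : Type*} [NormedAddCommGroup E]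
    [NormedSpace ℂ E] [NormedAddCommGroup F] [NormedSpace ℂ F] (L : E →L[ℂ] F) {γ : ℂ → E}
    {y : ℂ} {n : ℕ} (hγ : ContDiffAt ℂ n γ y) :
    iteratedDeriv n (fun t => L (γ t)) y = L (iteratedDeriv n γ y) := by
  have := L.iteratedFDeriv_comp_left hγ le_rfl
  simp only [iteratedDeriv_eq_iteratedFDeriv]
  exact congrArg (fun m => m fun _ => 1) this

open Metric in
/-- The Cauchy integral of `G` in the first variable is jointly analytic, and its derivatives in
the second variable may be computed under the integral sign. -/
theorem analyticAt_cauchyIntegral_fst {G : ℂ × ℂ → ℂ} {r : ℝ}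
    (hG : ∀ ζ ∈ sphere (0 : ℂ) r, AnalyticAt ℂ G (ζ, 0)) {x : ℂ} (hx : x ∈ ball (0 : ℂ) r) :
    AnalyticAt ℂ (fun w : ℂ × ℂ => ∮ ζ in C(0, r), (ζ - w.1)⁻¹ • G (ζ, w.2)) (x, 0) ∧
      ∀ n, iteratedDeriv n (fun y => ∮ ζ in C(0, r), (ζ - x)⁻¹ • G (ζ, y)) 0 =
        ∮ ζ in C(0, r), (ζ - x)⁻¹ • iteratedDeriv n (fun y => G (ζ, y)) 0 := by
  have hr : 0 < r := (norm_nonneg _).trans_lt (mem_ball_zero_iff.1 hx)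
  obtain ⟨L, hL⟩ := exists_circleIntegral_clm hr.le
  obtain ⟨Γ, hΓ, hΓG⟩ := exists_analyticAt_continuousMap hG
  let ι : C(sphere (0 : ℂ) r, ℂ) := ⟨fun ζ => ζ, continuous_subtype_val⟩
  have hsub : ∀ x' ∈ ball (0 : ℂ) r, ∀ ζ : sphere (0 : ℂ) r, (ζ : ℂ) - x' ≠ 0 :=
    fun x' hx' ζ h0 => by
      have := ζ.2
      rw [sub_eq_zero.1 h0, mem_sphere] at this
      exact (mem_ball.1 hx').ne this
  have hinv : ∀ x' ∈ ball (0 : ℂ) r, ∃ k : (C(sphere (0 : ℂ) r, ℂ))ˣ,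
      (k : C(sphere (0 : ℂ) r, ℂ)) = ι - algebraMap ℂ _ x' := fun x' hx' =>
    ⟨⟨ι - algebraMap ℂ _ x', ⟨fun ζ => ((ζ : ℂ) - x')⁻¹,
        (continuous_subtype_val.sub continuous_const).inv₀ (hsub x' hx')⟩,
      by ext ζ; exact mul_inv_cancel₀ (hsub x' hx' ζ),
      by ext ζ; exact inv_mul_cancel₀ (hsub x' hx' ζ)⟩, rfl⟩
  -- The Cauchy kernel is an inverse in the Banach algebra of continuous functions on the circle,
  -- hence analytic in `x'`. The integral becomes `L (k x * Γ y)`, which gives joint analyticity and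
  -- differentiation under the integral at once.
  let k : ℂ → C(sphere (0 : ℂ) r, ℂ) := fun x' => Ring.inverse (ι - algebraMap ℂ _ x')
  have hk : ∀ x' ∈ ball (0 : ℂ) r, ∀ ζ : sphere (0 : ℂ) r, k x' ζ = ((ζ : ℂ) - x')⁻¹ := by
    intro x' hx' ζ
    obtain ⟨u, hu⟩ := hinv x' hx'
    have h1 : (ι - algebraMap ℂ _ x') * k x' = 1 :=
      Ring.mul_inverse_cancel _ ⟨u, hu⟩
    have h2 := congrArg (fun φ : C(sphere (0 : ℂ) r, ℂ) => φ ζ) h1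
    exact eq_inv_of_mul_eq_one_right h2
  have hkan : AnalyticAt ℂ k x := by
    obtain ⟨u, hu⟩ := hinv x hx
    have h1 : AnalyticAt ℂ Ring.inverse (ι - algebraMap ℂ (C(sphere (0 : ℂ) r, ℂ)) x) :=
      hu ▸ analyticAt_inverse u
    refine h1.comp (f := fun x' : ℂ => ι - algebraMap ℂ (C(sphere (0 : ℂ) r, ℂ)) x') ?_
    exact analyticAt_const.sub ((Algebra.linearMap ℂ
      (C(sphere (0 : ℂ) r, ℂ))).toContinuousLinearMap.analyticAt x)
  constructor
  · have han : AnalyticAt ℂ (fun w : ℂ × ℂ => L (k w.1 * Γ w.2)) (x, 0) :=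
      (L.analyticAt _).comp
        ((hkan.comp_of_eq (f := fun w : ℂ × ℂ => w.1) analyticAt_fst rfl).mul
          (hΓ.comp_of_eq (f := fun w : ℂ × ℂ => w.2) analyticAt_snd rfl))
    refine han.congr ?_
    have e1 : ∀ᶠ w : ℂ × ℂ in 𝓝 (x, 0), w.1 ∈ ball (0 : ℂ) r :=
      continuous_fst.continuousAt.eventually (isOpen_ball.mem_nhds hx)
    have e2 : ∀ᶠ w : ℂ × ℂ in 𝓝 (x, 0), ∀ ζ : sphere (0 : ℂ) r, Γ w.2 ζ = G (ζ, w.2) :=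
      (continuous_snd.tendsto (x, (0 : ℂ))).eventually hΓG
    filter_upwards [e1, e2] with w h1 h2
    exact hL _ (fun ζ => (ζ - w.1)⁻¹ • G (ζ, w.2)) fun ζ => by
      rw [ContinuousMap.mul_apply, hk _ h1, h2, smul_eq_mul]
  · intro n
    have hev : (fun y => ∮ ζ in C(0, r), (ζ - x)⁻¹ • G (ζ, y)) =ᶠ[𝓝 0]
        fun y => (L.comp (ContinuousLinearMap.mul ℂ _ (k x))) (Γ y) := by
      filter_upwards [hΓG] with y hy
      refine (hL _ (fun ζ => (ζ - x)⁻¹ • G (ζ, y)) fun ζ => ?_).symm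
      change k x ζ * Γ y ζ = _
      rw [hk _ hx, hy, smul_eq_mul]
    rw [hev.iteratedDeriv_eq, ContinuousLinearMap.iteratedDeriv_comp_left _ hΓ.contDiffAt]
    refine hL _ (fun ζ => (ζ - x)⁻¹ • iteratedDeriv n (fun y => G (ζ, y)) 0) fun ζ => ?_
    have hζ : (fun y => G (ζ, y)) =ᶠ[𝓝 0] fun y => ContinuousMap.evalCLM ℂ ζ (Γ y) := by
      filter_upwards [hΓG] with y hy using (hy ζ).symm
    change k x ζ * iteratedDeriv n Γ 0 ζ = _
    rw [hk _ hx, hζ.iteratedDeriv_eq,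
      ContinuousLinearMap.iteratedDeriv_comp_left _ hΓ.contDiffAt, smul_eq_mul]
    rfl

/-- The derivatives in the second variable of an analytic function are analytic in the first. -/
theorem AnalyticAt.iteratedDeriv_snd {G : ℂ × ℂ → ℂ} {x y : ℂ} (hG : AnalyticAt ℂ G (x, y)) (n : ℕ) :
    AnalyticAt ℂ (fun x' => iteratedDeriv n (fun y' => G (x', y')) y) x := by
  -- The induction needs equality on a full neighbourhood in both variables, so that it can be
  -- differentiated again.
  have key : ∃ D : ℂ × ℂ → ℂ, AnalyticAt ℂ D (x, y) ∧
      ∀ᶠ w in 𝓝 (x, y), iteratedDeriv n (fun y' => G (w.1, y')) w.2 = D w := by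
    induction n with
    | zero => exact ⟨G, hG, .of_forall fun w => by simp⟩
    | succ n ih =>
      obtain ⟨D, hD, hev⟩ := ih
      refine ⟨fun w => fderiv ℂ D w (0, 1),
        ((ContinuousLinearMap.apply ℂ ℂ ((0, 1) : ℂ × ℂ)).analyticAt _).comp hD.fderiv, ?_⟩
      filter_upwards [hev.eventually_nhds, hD.eventually_analyticAt] with w hw hDw
      have hline : HasDerivAt (fun y' : ℂ => (w.1, y')) (0, 1) w.2 :=
        (hasDerivAt_const _ _).prodMk (hasDerivAt_id _)
      have h1 : iteratedDeriv n (fun y' => G (w.1, y')) =ᶠ[𝓝 w.2] fun y' => D (w.1, y') :=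
        hline.continuousAt.eventually hw
      rw [iteratedDeriv_succ, h1.deriv_eq]
      exact (hDw.differentiableAt.hasFDerivAt.comp_hasDerivAt w.2 hline).deriv
  obtain ⟨D, hD, hev⟩ := key
  have hline : AnalyticAt ℂ (fun x' : ℂ => (x', y)) x := analyticAt_id.prod analyticAt_const
  refine (hD.comp_of_eq hline rfl).congr ?_
  filter_upwards [hline.continuousAt.eventually hev] with x' hx'
  exact hx'.symm

/-! ### Divisibility by `y` and local quotients -/

/-- An analytic function that vanishes on the axis `y = 0` is divisible by `y`. -/
theorem holomorphicGermDvd_snd_of_eventually_eq_zero {h : ℂ × ℂ → ℂ} (hh : AnalyticAt ℂ h (0, 0))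
    (h0 : ∀ᶠ x in 𝓝 (0 : ℂ), h (x, 0) = 0) : HolomorphicGermDvd (fun w => w.2) h (0, 0) := by
  obtain ⟨R, hR, hball⟩ := Metric.eventually_nhds_iff_ball.1 hh.eventually_analyticAt
  have hr : 0 < R / 2 := half_pos hR
  -- The coordinates are swapped because the Cauchy lemma integrates in the first one. The Cauchy
  -- integral of `h (x, η) / η` in `η` is the quotient by `y`, jointly analytic even at `y = 0`.
  let H : ℂ × ℂ → ℂ := fun w => h (w.2, w.1) / w.1
  have hH : ∀ ζ ∈ Metric.sphere (0 : ℂ) (R / 2), AnalyticAt ℂ H (ζ, 0) := by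
    intro ζ hζ
    have hmem : ((0 : ℂ), ζ) ∈ Metric.ball ((0, 0) : ℂ × ℂ) R := by
      rw [← ball_prod_same]
      exact ⟨Metric.mem_ball_self hR, (Metric.mem_sphere.1 hζ).trans_lt (half_lt_self hR)⟩
    refine AnalyticAt.div ?_ analyticAt_fst ?_
    · exact (hball _ hmem).comp_of_eq (f := fun w : ℂ × ℂ => (w.2, w.1))
        (analyticAt_snd.prod analyticAt_fst) rfl
    · exact Metric.ne_of_mem_sphere hζ hr.ne'
  have hq := (analyticAt_cauchyIntegral_fst hH (Metric.mem_ball_self hr)).1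
  refine ⟨fun w => (2 * Real.pi * Complex.I : ℂ)⁻¹ •
    ∮ ζ in C(0, R / 2), (ζ - w.2)⁻¹ • H (ζ, w.1), ?_, ?_⟩
  · exact analyticAt_const.mul (hq.comp_of_eq (x := ((0 : ℂ), (0 : ℂ)))
      (f := fun w : ℂ × ℂ => (w.2, w.1)) (analyticAt_snd.prod analyticAt_fst) rfl)
  · have e1 : ∀ᶠ w : ℂ × ℂ in 𝓝 (0, 0), w ∈ Metric.ball ((0, 0) : ℂ × ℂ) (R / 2) :=
      Metric.ball_mem_nhds _ hr
    have e2 : ∀ᶠ w : ℂ × ℂ in 𝓝 (0, 0), h (w.1, 0) = 0 :=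
      (continuous_fst.tendsto ((0, 0) : ℂ × ℂ)).eventually h0
    filter_upwards [e1, e2] with w hw hw0
    rw [← ball_prod_same] at hw
    have hline : ∀ η ∈ Metric.ball (0 : ℂ) R, DifferentiableAt ℂ (fun η => h (w.1, η)) η := by
      intro η hη
      have hmem : (w.1, η) ∈ Metric.ball ((0, 0) : ℂ × ℂ) R := by
        rw [← ball_prod_same]
        exact ⟨Metric.ball_subset_ball (half_le_self hR.le) hw.1, hη⟩
      exact (hball _ hmem).differentiableAt.comp η (f := fun η : ℂ => (w.1, η)) (by fun_prop)
    have hdiff : DifferentiableOn ℂ (dslope (fun η => h (w.1, η)) 0)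
        (Metric.closedBall 0 (R / 2)) := by
      refine ((Complex.differentiableOn_dslope (Metric.ball_mem_nhds _ hR)).2
        fun η hη => (hline η hη).differentiableWithinAt).mono ?_
      exact Metric.closedBall_subset_ball (half_lt_self hR)
    have hint : (∮ ζ in C(0, R / 2), (ζ - w.2)⁻¹ • H (ζ, w.1)) =
        ∮ ζ in C(0, R / 2), (ζ - w.2)⁻¹ • dslope (fun η => h (w.1, η)) 0 ζ := by
      refine circleIntegral.integral_congr hr.le fun ζ hζ => ?_
      simp only [H]
      rw [dslope_of_ne _ (Metric.ne_of_mem_sphere hζ hr.ne'), slope_def_field, hw0, sub_zero,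
        sub_zero]
    rw [hint, hdiff.circleIntegral_sub_inv_smul hw.2, smul_smul,
      inv_mul_cancel₀ Complex.two_pi_I_ne_zero, one_smul]
    have := sub_smul_dslope (fun η => h (w.1, η)) 0 w.2
    simp only [sub_zero, smul_eq_mul, hw0] at this
    exact this.symm

/-- If both factors vanished at the origin, so would the `y`-derivative of their product, whereas
that of `y` is `1`. -/
theorem isIrreducibleHolomorphicGerm_snd :
    IsIrreducibleHolomorphicGerm (fun w => w.2) (0, 0) := by
  refine ⟨analyticAt_snd, rfl, fun a b ha hb hab => ?_⟩
  by_contra! hcon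
  have hline : HasDerivAt (fun y : ℂ => ((0 : ℂ), y)) (0, 1) 0 :=
    (hasDerivAt_const _ _).prodMk (hasDerivAt_id _)
  have h1 := (ha.differentiableAt.hasFDerivAt.comp_hasDerivAt (0 : ℂ) hline).mul
    (hb.differentiableAt.hasFDerivAt.comp_hasDerivAt (0 : ℂ) hline)
  have h2 : (fun y : ℂ => y) =ᶠ[𝓝 0] fun y => a (0, y) * b (0, y) :=
    hline.continuousAt.eventually hab
  have h3 := (h1.congr_of_eventuallyEq h2).unique (hasDerivAt_id (0 : ℂ))
  simp [hcon.1, hcon.2] at h3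

/-- A local quotient is holomorphic wherever its denominator does not vanish. -/
theorem IsLocalQuotient.isHolomorphicExtensionAt {f g h : ℂ × ℂ → ℂ} {z : ℂ × ℂ}
    (H : IsLocalQuotient f g h z) :
    ∀ᶠ w in 𝓝 z, h w ≠ 0 → IsHolomorphicExtensionAt (fun w => g w / h w) f w := by
  obtain ⟨hg, ⟨hh, -⟩, hf⟩ := H
  filter_upwards [hg.eventually_analyticAt, hh.eventually_analyticAt, hf.eventually_nhds]
    with w hgw hhw hfw hw
  exact ⟨hgw.div hhw hw, h, ⟨hhw, (hhw.continuousAt.eventually_ne hw).frequently⟩, hfw⟩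

theorem AnalyticAt.eventuallyEq_of_iteratedDeriv_eq {u v : ℂ → ℂ} {y : ℂ} (hu : AnalyticAt ℂ u y)
    (hv : AnalyticAt ℂ v y) (h : ∀ n, iteratedDeriv n u y = iteratedDeriv n v y) : u =ᶠ[𝓝 y] v := by
  have h1 := hu.hasFPowerSeriesAt
  have h2 := hv.hasFPowerSeriesAt
  simp only [h] at h1
  obtain ⟨r₁, h1⟩ := h1
  obtain ⟨r₂, h2⟩ := h2
  have e1 := Metric.eball_mem_nhds y h1.r_pos
  have e2 := Metric.eball_mem_nhds y h2.r_pos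
  filter_upwards [e1, e2] with t ht1 ht2
  exact (h1.hasSum_sub ht1).unique (h2.hasSum_sub ht2)

/-! ### Continuation across the origin -/

/-- A quotient of holomorphic germs whose denominator does not vanish identically on the axis
`y = 0` is holomorphic if all its `y`-derivatives on the axis continue holomorphically. -/
theorem IsLocalQuotient.meromorphicIsHolomorphicAt {f g h : ℂ × ℂ → ℂ}
    (H : IsLocalQuotient f g h (0, 0)) (hax : ∃ᶠ x in 𝓝 (0 : ℂ), h (x, 0) ≠ 0)
    (h_deriv : ∀ n : ℕ, ∃ a : ℂ → ℂ, IsContinuationOfYDeriv f n a) :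
    MeromorphicIsHolomorphicAt f (0, 0) := by
  have hline : AnalyticAt ℂ (fun x : ℂ => (x, (0 : ℂ))) 0 := analyticAt_id.prod analyticAt_const
  have hh0 : AnalyticAt ℂ (fun x => h (x, 0)) 0 := H.2.1.1.comp_of_eq hline rfl
  have hne : ∀ᶠ x in 𝓝 (0 : ℂ), x ≠ 0 → h (x, 0) ≠ 0 :=
    eventually_nhdsWithin_iff.1 <| hh0.eventually_eq_zero_or_eventually_ne_zero.resolve_left
      fun hz => hax (hz.mono fun x hx => not_not.2 hx)
  set G : ℂ × ℂ → ℂ := fun w => g w / h w with hGdef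
  have hext : ∀ᶠ x in 𝓝 (0 : ℂ), x ≠ 0 → IsHolomorphicExtensionAt G f (x, 0) := by
    filter_upwards [hline.continuousAt.eventually H.isHolomorphicExtensionAt, hne] with x h1 h2 h3
    exact h1 (h2 h3)
  choose a ha using h_deriv
  have hca : ∀ n, ∀ᶠ x in 𝓝 (0 : ℂ), x ≠ 0 → iteratedDeriv n (fun y => G (x, y)) 0 = a n x := by
    intro n
    filter_upwards [(ha n).2, hext] with x h1 h2 h3
    exact h1 G (h2 h3)
  obtain ⟨R, hR, hball⟩ := Metric.eventually_nhds_iff_ball.1 hext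
  have hr : 0 < R / 2 := half_pos hR
  have hGan : ∀ x ∈ Metric.ball (0 : ℂ) R, x ≠ 0 → AnalyticAt ℂ G (x, 0) :=
    fun x hx hx0 => (hball x hx hx0).1
  have hsphere : ∀ ζ ∈ Metric.sphere (0 : ℂ) (R / 2), AnalyticAt ℂ G (ζ, 0) := fun ζ hζ =>
    hGan ζ ((Metric.mem_sphere.1 hζ).trans_lt (half_lt_self hR)) (Metric.ne_of_mem_sphere hζ hr.ne')
  have hcoeff : ∀ n, ∀ x ∈ Metric.ball (0 : ℂ) (R / 2), x ≠ 0 →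
      (∮ ζ in C(0, R / 2), (ζ - x)⁻¹ • iteratedDeriv n (fun y => G (ζ, y)) 0) =
        (2 * Real.pi * Complex.I : ℂ) • iteratedDeriv n (fun y => G (x, y)) 0 := by
    intro n x hx hx0
    let c : ℂ → ℂ := fun ζ => iteratedDeriv n (fun y => G (ζ, y)) 0
    -- The continuation `a n` serves only to fill the puncture at `0`; elsewhere the coefficient is
    -- already analytic. The radius is therefore independent of `n`, although the domain of `a n`
    -- may shrink.
    have hdiff : DifferentiableOn ℂ (Function.update c 0 (a n 0))
        (Metric.closedBall 0 (R / 2)) := by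
      intro ζ hζ
      refine DifferentiableAt.differentiableWithinAt ?_
      by_cases hζ0 : ζ = 0
      · subst hζ0
        refine (ha n).1.differentiableAt.congr_of_eventuallyEq ?_
        filter_upwards [hca n] with t ht
        by_cases ht0 : t = 0
        · simp [ht0]
        · rw [Function.update_of_ne ht0]
          exact ht ht0
      · have hcζ : AnalyticAt ℂ c ζ := (hGan ζ
          (Metric.closedBall_subset_ball (half_lt_self hR) hζ) hζ0).iteratedDeriv_snd n
        refine hcζ.differentiableAt.congr_of_eventuallyEq ?_
        filter_upwards [eventually_ne_nhds hζ0] with t ht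
        rw [Function.update_of_ne ht]
    have hC := hdiff.circleIntegral_sub_inv_smul hx
    rw [Function.update_of_ne hx0] at hC
    rw [← hC]
    refine circleIntegral.integral_congr hr.le fun ζ hζ => ?_
    simp only [Function.update_of_ne (Metric.ne_of_mem_sphere hζ hr.ne'), c]
  let F : ℂ × ℂ → ℂ := fun w =>
    (2 * Real.pi * Complex.I : ℂ)⁻¹ • ∮ ζ in C(0, R / 2), (ζ - w.1)⁻¹ • G (ζ, w.2)
  have hFan : ∀ x ∈ Metric.ball (0 : ℂ) (R / 2), AnalyticAt ℂ F (x, 0) := fun x hx =>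
    analyticAt_const.mul (analyticAt_cauchyIntegral_fst hsphere hx).1
  have hFG : ∀ x ∈ Metric.ball (0 : ℂ) (R / 2), x ≠ 0 → ∀ᶠ y in 𝓝 (0 : ℂ), F (x, y) = G (x, y) := by
    intro x hx hx0
    have hl : AnalyticAt ℂ (fun y : ℂ => (x, y)) 0 := analyticAt_const.prod analyticAt_id
    refine AnalyticAt.eventuallyEq_of_iteratedDeriv_eq ((hFan x hx).comp_of_eq hl rfl)
      ((hGan x (Metric.ball_subset_ball (half_le_self hR.le) hx) hx0).comp_of_eq hl rfl) fun n => ?_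
    change iteratedDeriv n (fun y => (2 * Real.pi * Complex.I : ℂ)⁻¹ •
      ∮ ζ in C(0, R / 2), (ζ - x)⁻¹ • G (ζ, y)) 0 = iteratedDeriv n (fun y => G (x, y)) 0
    rw [iteratedDeriv_fun_const_smul_field, (analyticAt_cauchyIntegral_fst hsphere hx).2,
      hcoeff n x hx hx0, smul_smul, inv_mul_cancel₀ Complex.two_pi_I_ne_zero, one_smul]
  have hF0 := hFan 0 (Metric.mem_ball_self hr)
  -- `F = G` is known only for `y` near `0`, how near depending on `x`. Clearing the denominator
  -- gives a function analytic on a vertical disc of fixed radius `ρ`, where `h` may vanish, and the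
  -- identity theorem applies there.
  have hprod : ∀ᶠ w : ℂ × ℂ in 𝓝 (0, 0), w.1 ≠ 0 → h w * F w - g w = 0 := by
    have han : AnalyticAt ℂ (fun w => h w * F w - g w) (0, 0) := (H.2.1.1.mul hF0).sub H.1
    have hx : ∀ᶠ w : ℂ × ℂ in 𝓝 (0, 0), w.1 ∈ Metric.ball (0 : ℂ) (R / 2) ∧
        (w.1 ≠ 0 → h (w.1, 0) ≠ 0) :=
      (continuous_fst.tendsto ((0, 0) : ℂ × ℂ)).eventually
        (Filter.Eventually.and (Metric.ball_mem_nhds (0 : ℂ) hr) hne)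
    obtain ⟨ρ, hρ, hρb⟩ := Metric.eventually_nhds_iff_ball.1
      ((han.eventually_analyticAt.and hx).and H.2.1.1.eventually_analyticAt)
    filter_upwards [Metric.ball_mem_nhds ((0, 0) : ℂ × ℂ) hρ] with w hw hw0
    obtain ⟨hwr, hwh⟩ := (hρb w hw).1.2
    rw [← ball_prod_same] at hw
    have hmem : ∀ y ∈ Metric.ball (0 : ℂ) ρ, (w.1, y) ∈ Metric.ball ((0, 0) : ℂ × ℂ) ρ :=
      fun y hy => by rw [← ball_prod_same]; exact ⟨hw.1, hy⟩
    have hl : ∀ y, AnalyticAt ℂ (fun y : ℂ => (w.1, y)) y :=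
      fun y => analyticAt_const.prod analyticAt_id
    have hon : AnalyticOnNhd ℂ (fun y => h (w.1, y) * F (w.1, y) - g (w.1, y))
        (Metric.ball 0 ρ) := fun y hy => (hρb _ (hmem y hy)).1.1.comp_of_eq (hl y) rfl
    have hhc : ContinuousAt (fun y => h (w.1, y)) 0 :=
      ((hρb _ (hmem 0 (Metric.mem_ball_self hρ))).2.comp_of_eq (hl 0) rfl).continuousAt
    have hzero : (fun y => h (w.1, y) * F (w.1, y) - g (w.1, y)) =ᶠ[𝓝 0] 0 := by
      filter_upwards [hFG w.1 hwr hw0, hhc.eventually_ne (hwh hw0)] with y h1 h2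
      simp only [h1, hGdef, Pi.zero_apply]
      rw [mul_div_cancel₀ _ h2, sub_self]
    exact hon.eqOn_zero_of_preconnected_of_eventuallyEq_zero
      (convex_ball (0 : ℂ) ρ).isPreconnected (Metric.mem_ball_self hρ) hzero hw.2
  -- The factor `w.1` discards the line `x = 0`, where `hprod` says nothing.
  refine ⟨F, hF0, fun w => w.1 * h w, ⟨analyticAt_fst.mul H.2.1.1, ?_⟩, ?_⟩
  · have hfr : ∃ᶠ x in 𝓝 (0 : ℂ), x ≠ 0 ∧ h (x, 0) ≠ 0 :=
      (mem_closure_iff_frequently.1 (dense_compl_singleton (0 : ℂ) 0)).and_eventually hne |>.mono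
        fun x hx => ⟨hx.1, hx.2 hx.1⟩
    exact (hline.continuousAt.tendsto.frequently
      (p := fun w : ℂ × ℂ => w.1 * h w ≠ 0) (hfr.mono fun x hx => mul_ne_zero hx.1 hx.2))
  · filter_upwards [hprod, H.2.2] with w h1 h2 h3
    have hw1 := left_ne_zero_of_mul h3
    have hw2 := right_ne_zero_of_mul h3
    rw [h2 hw2, div_eq_iff hw2, mul_comm, sub_eq_zero.1 (h1 hw1)]

theorem mainTheorem5 (f : ℂ × ℂ → ℂ) (U : Set (ℂ × ℂ)) (hU : U ∈ 𝓝 ((0, 0) : ℂ × ℂ))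
    (hf : IsMeromorphicOnTwo f U)
    (h_axis : ¬ IsPolarDivisorGerm f (fun w => w.2) (0, 0))
    (h_branch : ∀ p : ℂ × ℂ → ℂ, IsPolarDivisorGerm f p (0, 0) → ¬ HasBranchingPointAt p (0, 0))
    (h_deriv : ∀ n : ℕ, ∃ a : ℂ → ℂ, IsContinuationOfYDeriv f n a) :
    MeromorphicIsHolomorphicAt f (0, 0) 
:= by
  rw [IsPolarDivisorGerm, not_and] at h_axis
  have h1 := h_axis isIrreducibleHolomorphicGerm_snd
  push Not at h1
  obtain ⟨g, h, H, hdvd⟩ := h1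
  refine H.meromorphicIsHolomorphicAt ?_ h_deriv
  by_contra hcon
  refine hdvd (holomorphicGermDvd_snd_of_eventually_eq_zero H.2.1.1 ?_)
  exact (not_frequently.1 hcon).mono fun x hx => not_not.1 hx
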